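/- Let $d\ge 1$ and let $V$ be a positive definite $d\times d$ real symmetric matrix whose diagonal entries all equal $1$; let $\sqrt V$ be its positive semi-definite square root and $e_1,\dots,e_d$ the standard basis of $\mathbb{R}^d$. Let $(i_n)_{n\ge 0}$ be independent random variables uniformly distributed over $\{1,\dots,d\}$, let $(g_n)_{n\ge 0}$ be independent standard Gaussian random variables, independent of $(i_n)_{n\ge 0}$, and let $Z_0\sim N(0,I)$ be a $d$-dimensional vector independent of $(g_n,i_n)_{n\ge 0}$. Define $X_0=0$ and $$X_{n+1}=X_n+(g_n-e_{i_n}^TX_n)\,V e_{i_n},\qquad n\ge 0.$$ Put $f_k=\sqrt V e_k$, $P_k=I-f_kf_k^T$, $Y_0=0$, $Y_{n+1}=P_{i_n}Y_n+g_nf_{i_n}$, $M_0=I$, $M_n=P_{i_{n-1}}\cdots P_{i_0}$, and $Z_n=Y_n+M_nZ_0$ (the stationary auxiliary chain). Let $\kappa>0$ and $\gamma\in(0,1]$, and let the Borel function $h:\mathbb{R}^d\to\mathbb{R}$ be $(\kappa,\gamma,V)$-Lipschitz, that is, $$E\big((h(X)-h(X'))^2\big)\le\kappa^2\big(E(\|X-X'\|^2)\big)^{\gamma}$$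 for every centered, possibly degenerate, Gaussian vector $(X,X')$ in $\mathbb{R}^d\times\mathbb{R}^d$ such that $V-\mathrm{cov}(X)$ and $V-\mathrm{cov}(X')$ are positive semi-definite. Let $m=E(h(X))$ for $X\sim N(0,V)$. Then $h(X)$ for $X\sim N(0,V)$, and $h(X_j)$ and $h(\sqrt V Z_j)$ for all $j\ge 0$, are square integrable, the series in $$c=\mathrm{Var}\big(h(\sqrt V Z_0)\big)+2\sum_{j=1}^{\infty}\mathrm{Cov}\big(h(\sqrt V Z_0),h(\sqrt V Z_j)\big)$$ converges absolutely, and $$\lim_{n\to\infty} n\,E\left(\Big(\frac{1}{n}\sum_{j=0}^{n-1}h(X_j)-m\Big)^2\right)=c .$$ -/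

import Mathlib

open MeasureTheory ProbabilityTheory Filter Topology
open scoped Matrix MatrixOrder ENNReal

namespace GaussSim

/-- The covariance matrix `E(X Xᵀ)` of a centered random vector `X : Ω → ℝᵈ`. -/
noncomputable def covMat {Ω : Type*} [MeasurableSpace Ω] {d : ℕ}
    (X : Ω → EuclideanSpace ℝ (Fin d)) (P : Measure Ω) : Matrix (Fin d) (Fin d) ℝ :=
  Matrix.of fun k l => ∫ ω, X ω k * X ω l ∂P

/-- `h` is `(κ, γ, W)`-Lipschitz: `h` is Borel, and for every centered (possibly degenerate)
Gaussian vector `(X, X')` in `ℝᵈ × ℝᵈ` with `cov X ≤ W` and `cov X' ≤ W` in the Loewner order,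
`E (h X - h X')² ≤ κ² (E ‖X - X'‖²) ^ γ`. Here `μ` is the law of `(X, X')`, and the left-hand
side is an expectation in `[0, ∞]`, so the inequality includes its finiteness. -/
def IsGaussLipschitz {d : ℕ} (κ γ : ℝ) (W : Matrix (Fin d) (Fin d) ℝ)
    (h : EuclideanSpace ℝ (Fin d) → ℝ) : Prop :=
  Measurable h ∧
    ∀ μ : Measure (EuclideanSpace ℝ (Fin d) × EuclideanSpace ℝ (Fin d)),
      IsGaussian μ → ∫ p, p ∂μ = 0 →
      (W - covMat Prod.fst μ).PosSemidef → (W - covMat Prod.snd μ).PosSemidef →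
      ∫⁻ p, ENNReal.ofReal ((h p.1 - h p.2) ^ 2) ∂μ ≤
        ENNReal.ofReal (κ ^ 2 * (∫ p, ‖p.1 - p.2‖ ^ 2 ∂μ) ^ γ)

section Chains

variable {d : ℕ}

/-- A matrix acting on a vector of `ℝᵈ`. -/
noncomputable def act (A : Matrix (Fin d) (Fin d) ℝ) (x : EuclideanSpace ℝ (Fin d)) :
    EuclideanSpace ℝ (Fin d) :=
  Matrix.toEuclideanCLM (𝕜 := ℝ) A x

/-- The path of the chain `X₀ = 0`, `Xₙ₊₁ = Xₙ + (gₙ - eᵀ Xₙ) (V e)` with `e` the basis vector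
of index `iₙ`. -/
noncomputable def chainX (V : Matrix (Fin d) (Fin d) ℝ) (i : ℕ → Fin d) (g : ℕ → ℝ) :
    ℕ → EuclideanSpace ℝ (Fin d)
  | 0 => 0
  | n + 1 => chainX V i g n +
      (g n - chainX V i g n (i n)) • act V (EuclideanSpace.single (i n) 1)

/-- The vector `√V e_k`, with `√V` the positive semidefinite square root of `V`. -/
noncomputable def vecF (V : Matrix (Fin d) (Fin d) ℝ) (k : Fin d) : EuclideanSpace ℝ (Fin d) :=
  act (CFC.sqrt V) (EuclideanSpace.single k 1)

/-- The matrix `I - f fᵀ` with `f = √V e_k`. -/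
noncomputable def matP (V : Matrix (Fin d) (Fin d) ℝ) (k : Fin d) : Matrix (Fin d) (Fin d) ℝ :=
  1 - Matrix.vecMulVec (vecF V k).ofLp (vecF V k).ofLp

/-- The auxiliary chain `Y₀ = 0`, `Yₙ₊₁ = P Yₙ + gₙ f`, with `P`, `f` of index `iₙ`. -/
noncomputable def chainY (V : Matrix (Fin d) (Fin d) ℝ) (i : ℕ → Fin d) (g : ℕ → ℝ) :
    ℕ → EuclideanSpace ℝ (Fin d)
  | 0 => 0
  | n + 1 => act (matP V (i n)) (chainY V i g n) + g n • vecF V (i n)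

/-- The product of the matrices `P` of indices `iₙ₋₁, …, i₀`, in this order. -/
noncomputable def matM (V : Matrix (Fin d) (Fin d) ℝ) (i : ℕ → Fin d) :
    ℕ → Matrix (Fin d) (Fin d) ℝ
  | 0 => 1
  | n + 1 => matP V (i n) * matM V i n

/-- The stationary auxiliary chain `Zₙ = Yₙ + Mₙ Z₀`. -/
noncomputable def chainZ (V : Matrix (Fin d) (Fin d) ℝ) (i : ℕ → Fin d) (g : ℕ → ℝ)
    (z : EuclideanSpace ℝ (Fin d)) (n : ℕ) : EuclideanSpace ℝ (Fin d) :=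
  chainY V i g n + act (matM V i n) z

end Chains

section Estimator

variable {Ω : Type*} [MeasurableSpace Ω] {d : ℕ}

/-- `m = E h(X)` with `X ∼ N(0, V)`. -/
noncomputable def gaussMean (V : Matrix (Fin d) (Fin d) ℝ)
    (h : EuclideanSpace ℝ (Fin d) → ℝ) : ℝ :=
  ∫ x, h x ∂(multivariateGaussian 0 V)

/-- The random variable `h(Xₙ)`. -/
noncomputable def obsX (V : Matrix (Fin d) (Fin d) ℝ) (h : EuclideanSpace ℝ (Fin d) → ℝ)
    (i : ℕ → Ω → Fin d) (g : ℕ → Ω → ℝ) (n : ℕ) (ω : Ω) : ℝ :=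
  h (chainX V (fun k => i k ω) (fun k => g k ω) n)

/-- The random variable `h(√V Zₙ)`. -/
noncomputable def obsZ (V : Matrix (Fin d) (Fin d) ℝ) (h : EuclideanSpace ℝ (Fin d) → ℝ)
    (i : ℕ → Ω → Fin d) (g : ℕ → Ω → ℝ) (Z₀ : Ω → EuclideanSpace ℝ (Fin d)) (n : ℕ) (ω : Ω) : ℝ :=
  h (act (CFC.sqrt V) (chainZ V (fun k => i k ω) (fun k => g k ω) (Z₀ ω) n))

/-- The mean square error of `n⁻¹ (h(X₀) + ⋯ + h(Xₙ₋₁))` as an estimator of `m`. -/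
noncomputable def mse (P : Measure Ω) (V : Matrix (Fin d) (Fin d) ℝ)
    (h : EuclideanSpace ℝ (Fin d) → ℝ) (i : ℕ → Ω → Fin d) (g : ℕ → Ω → ℝ) (n : ℕ) : ℝ :=
  ∫ ω, ((∑ j ∈ Finset.range n, obsX V h i g j ω) / n - gaussMean V h) ^ 2 ∂P

/-- `c = Var(h(√V Z₀)) + 2 ∑_{j ≥ 1} Cov(h(√V Z₀), h(√V Z_j))`. -/
noncomputable def asympVar (P : Measure Ω) (V : Matrix (Fin d) (Fin d) ℝ)
    (h : EuclideanSpace ℝ (Fin d) → ℝ) (i : ℕ → Ω → Fin d) (g : ℕ → Ω → ℝ)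
    (Z₀ : Ω → EuclideanSpace ℝ (Fin d)) : ℝ :=
  Var[obsZ V h i g Z₀ 0; P] +
    2 * ∑' j : ℕ, cov[obsZ V h i g Z₀ 0, obsZ V h i g Z₀ (j + 1); P]

end Estimator

end GaussSim

namespace GaussSim

open scoped RealInnerProductSpace

section L2

variable {Ω : Type*} [MeasurableSpace Ω] {P : Measure Ω}

lemma eLpNorm_two_sq (f : Ω → ℝ) :
    eLpNorm f 2 P ^ 2 = ∫⁻ ω, ENNReal.ofReal (f ω ^ 2) ∂P := by
  have h := eLpNorm_nnreal_pow_eq_lintegral (μ := P) (f := f) (p := 2) (by norm_num)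
  norm_num at h
  rw [h]
  refine lintegral_congr fun ω => ?_
  rw [← enorm_pow, Real.enorm_of_nonneg (sq_nonneg _)]

lemma MemLp.toReal_eLpNorm_two_sq {f : Ω → ℝ} (hf : MemLp f 2 P) :
    (eLpNorm f 2 P).toReal ^ 2 = ∫ ω, f ω ^ 2 ∂P := by
  rw [← ENNReal.toReal_pow, eLpNorm_two_sq,
    integral_eq_lintegral_of_nonneg_ae (ae_of_all _ fun _ => sq_nonneg _)
      (hf.aestronglyMeasurable.pow 2)]

lemma memLp_two_of_lintegral_sq_lt_top {f : Ω → ℝ} (hf : AEStronglyMeasurable f P)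
    (h : ∫⁻ ω, ENNReal.ofReal (f ω ^ 2) ∂P < ∞) : MemLp f 2 P := by
  refine ⟨hf, ?_⟩
  rw [← eLpNorm_two_sq] at h
  by_contra hn
  rw [not_lt, top_le_iff] at hn
  simp [hn] at h

lemma tendsto_sq_div_of_abs_sub_le {α β : ℕ → ℝ} {K c : ℝ} (hαβ : ∀ n, |β n - α n| ≤ K)
    (h : Tendsto (fun n : ℕ => α n ^ 2 / n) atTop (𝓝 c)) :
    Tendsto (fun n : ℕ => β n ^ 2 / n) atTop (𝓝 c) := by
  have hD : Tendsto (fun n : ℕ => (β n - α n) / √n) atTop (𝓝 0) := by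
    have h1 : Tendsto (fun n : ℕ => K / √(n : ℝ)) atTop (𝓝 0) :=
      Tendsto.div_atTop tendsto_const_nhds
        (Real.tendsto_sqrt_atTop.comp tendsto_natCast_atTop_atTop)
    refine squeeze_zero_norm (fun n => ?_) h1
    rw [norm_div, Real.norm_eq_abs, Real.norm_of_nonneg (Real.sqrt_nonneg _)]
    exact div_le_div_of_nonneg_right (hαβ n) (Real.sqrt_nonneg _)
  have hA : Tendsto (fun n : ℕ => |α n| / √n) atTop (𝓝 (√c)) := by
    refine ((Real.continuous_sqrt.tendsto c).comp h).congr fun n => ?_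
    simp only [Function.comp]
    rw [Real.sqrt_div (sq_nonneg _), Real.sqrt_sq_eq_abs]
  have hAD : Tendsto (fun n : ℕ => (α n / √n) * ((β n - α n) / √n)) atTop (𝓝 0) := by
    have h2 := hA.mul (hD.norm)
    rw [norm_zero, mul_zero] at h2
    refine squeeze_zero_norm (fun n => le_of_eq ?_) h2
    rw [norm_mul, norm_div (α n), Real.norm_eq_abs (α n), Real.norm_of_nonneg (Real.sqrt_nonneg _)]
  have h3 := (h.add (hAD.const_mul 2)).add (hD.pow 2)
  simp only [mul_zero, add_zero, ne_eq, OfNat.ofNat_ne_zero, not_false_eq_true, zero_pow] at h3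
  refine h3.congr fun n => ?_
  have hs : √(n : ℝ) ^ 2 = n := Real.sq_sqrt (Nat.cast_nonneg n)
  rw [div_mul_div_comm, div_pow, ← sq (√(n : ℝ)), hs]
  ring

variable [IsProbabilityMeasure P]

lemma tendsto_variance_sum_div {a : ℕ → Ω → ℝ} (ha : ∀ n, MemLp (a n) 2 P) {c : ℕ → ℝ}
    (hc : ∀ j k, cov[a j, a (j + k); P] = c k) (hs : Summable fun k => c (k + 1)) :
    Tendsto (fun n : ℕ => Var[∑ j ∈ Finset.range n, a j; P] / n) atTop
      (𝓝 (c 0 + 2 * ∑' k, c (k + 1))) := by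
  have hstep (n : ℕ) : Var[∑ j ∈ Finset.range (n + 1), a j; P] =
      Var[∑ j ∈ Finset.range n, a j; P] + (c 0 + 2 * ∑ k ∈ Finset.range n, c (k + 1)) := by
    rw [Finset.sum_range_succ, variance_add (memLp_finsetSum' _ fun j _ => ha j) (ha n),
      covariance_sum_left' (fun j _ => ha j) (ha n),
      ← covariance_self (ha n).aestronglyMeasurable.aemeasurable]
    have h0 := hc n 0
    rw [add_zero] at h0
    have : ∑ j ∈ Finset.range n, cov[a j, a n; P] = ∑ k ∈ Finset.range n, c (k + 1) := by
      rw [← Finset.sum_range_reflect (fun k => c (k + 1))]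
      refine Finset.sum_congr rfl fun j hj => ?_
      have hj' := Finset.mem_range.1 hj
      have := hc j (n - 1 - j + 1)
      rwa [show j + (n - 1 - j + 1) = n by omega] at this
    rw [h0, this]
    ring
  have hsum (n : ℕ) : Var[∑ j ∈ Finset.range n, a j; P] =
      ∑ i ∈ Finset.range n, (c 0 + 2 * ∑ k ∈ Finset.range i, c (k + 1)) := by
    induction n with
    | zero => simp
    | succ n ih => rw [hstep, ih, Finset.sum_range_succ]
  have := ((hs.hasSum.tendsto_sum_nat.const_mul 2).const_add (c 0)).cesaro
  refine this.congr fun n => ?_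
  rw [hsum, div_eq_inv_mul]

theorem tendsto_mul_integral_sq_of_stationary {a b : ℕ → Ω → ℝ} (ha : ∀ n, MemLp (a n) 2 P)
    (hb : ∀ n, MemLp (b n) 2 P) {m : ℝ} (hm : ∀ n, ∫ ω, a n ω ∂P = m) {c : ℕ → ℝ}
    (hc : ∀ j k, cov[a j, a (j + k); P] = c k) (hs : Summable fun k => c (k + 1))
    {K : ℝ≥0∞} (hK : K ≠ ∞)
    (hab : ∀ n, ∑ j ∈ Finset.range n, eLpNorm (b j - a j) 2 P ≤ K) :
    Tendsto (fun n : ℕ => (n : ℝ) * ∫ ω, ((∑ j ∈ Finset.range n, b j ω) / n - m) ^ 2 ∂P) atTop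
      (𝓝 (c 0 + 2 * ∑' k, c (k + 1))) := by
  set A : ℕ → Ω → ℝ := fun n ω => ∑ j ∈ Finset.range n, a j ω - n * m with hA
  set B : ℕ → Ω → ℝ := fun n ω => ∑ j ∈ Finset.range n, b j ω - n * m with hB
  have hAm (n : ℕ) : MemLp (A n) 2 P :=
    (memLp_finsetSum _ fun j _ => ha j).sub (memLp_const _)
  have hBm (n : ℕ) : MemLp (B n) 2 P :=
    (memLp_finsetSum _ fun j _ => hb j).sub (memLp_const _)
  have hBA (n : ℕ) : eLpNorm (B n - A n) 2 P ≤ K := by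
    have : B n - A n = ∑ j ∈ Finset.range n, (b j - a j) := by
      ext ω
      simp [hA, hB, Finset.sum_apply]
    rw [this]
    exact (eLpNorm_sum_le (fun j _ => ((hb j).sub (ha j)).aestronglyMeasurable)
      (by norm_num)).trans (hab n)
  have hdiff (n : ℕ) : |(eLpNorm (B n) 2 P).toReal - (eLpNorm (A n) 2 P).toReal| ≤ K.toReal := by
    have h1 : eLpNorm (B n) 2 P ≤ eLpNorm (A n) 2 P + K := by
      have := eLpNorm_add_le (hAm n).1 ((hBm n).sub (hAm n)).1 (p := 2) (by norm_num)
      rw [add_sub_cancel] at this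
      exact this.trans (by gcongr; exact hBA n)
    have h2 : eLpNorm (A n) 2 P ≤ eLpNorm (B n) 2 P + K := by
      have := eLpNorm_sub_le (hBm n).1 ((hBm n).sub (hAm n)).1 (p := 2) (by norm_num)
      rw [sub_sub_cancel] at this
      exact this.trans (by gcongr; exact hBA n)
    have h1' := ENNReal.toReal_mono (ENNReal.add_ne_top.2 ⟨(hAm n).2.ne, hK⟩) h1
    have h2' := ENNReal.toReal_mono (ENNReal.add_ne_top.2 ⟨(hBm n).2.ne, hK⟩) h2
    rw [ENNReal.toReal_add (hAm n).2.ne hK] at h1'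
    rw [ENNReal.toReal_add (hBm n).2.ne hK] at h2'
    rw [abs_le]
    constructor <;> linarith
  have hvar := tendsto_variance_sum_div ha hc hs
  have hα : Tendsto (fun n : ℕ => (eLpNorm (A n) 2 P).toReal ^ 2 / n) atTop
      (𝓝 (c 0 + 2 * ∑' k, c (k + 1))) := by
    refine hvar.congr fun n => ?_
    rw [MemLp.toReal_eLpNorm_two_sq (hAm n), variance_eq_integral
      (memLp_finsetSum' _ fun j _ => ha j).aestronglyMeasurable.aemeasurable]
    have : ∫ ω, (∑ j ∈ Finset.range n, a j) ω ∂P = n * m := by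
      simp only [Finset.sum_apply]
      rw [integral_finsetSum _ fun j _ => (ha j).integrable (by norm_num)]
      simp [hm]
    rw [this]
    simp [hA, Finset.sum_apply]
  refine (tendsto_sq_div_of_abs_sub_le hdiff hα).congr' ?_
  filter_upwards [eventually_gt_atTop 0] with n hn
  have hn' : (n : ℝ) ≠ 0 := by positivity
  rw [MemLp.toReal_eLpNorm_two_sq (hBm n), div_eq_iff hn', mul_right_comm, ← sq,
    ← integral_const_mul]
  refine integral_congr_ae (ae_of_all _ fun ω => ?_)
  simp only [hB]
  field_simp

end L2

section Iid

variable {β : Type*} [MeasurableSpace β] (ν : Measure β) [IsProbabilityMeasure ν]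

/-- The sequence with its first entry removed. -/
def shift {β : Type*} (x : ℕ → β) (n : ℕ) : β := x (n + 1)

@[fun_prop]
lemma measurable_shift : Measurable (shift : (ℕ → β) → ℕ → β) :=
  measurable_pi_lambda _ fun n => measurable_pi_apply (n + 1)

/-- Putting an entry in front of a sequence. -/
def cons {β : Type*} (p : β × (ℕ → β)) : ℕ → β
  | 0 => p.1
  | n + 1 => p.2 n

lemma measurable_cons : Measurable (cons : β × (ℕ → β) → ℕ → β) := by
  refine measurable_pi_lambda _ fun n => ?_
  cases n with
  | zero => exact measurable_fst
  | succ n => exact (measurable_pi_apply n).comp measurable_snd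

lemma map_cons_prod_infinitePi :
    (ν.prod (Measure.infinitePi fun _ : ℕ => ν)).map cons = Measure.infinitePi fun _ : ℕ => ν := by
  classical
  refine Measure.eq_infinitePi _ fun s t ht => ?_
  set t' : ℕ → Set β := fun n => if n ∈ s then t n else Set.univ with ht'
  have hmt' (n : ℕ) : MeasurableSet (t' n) := by
    simp only [ht']; split_ifs
    · exact ht n
    · exact .univ
  obtain ⟨N, hN⟩ : ∃ N, s ⊆ Finset.range (N + 1) :=
    ⟨s.sup id, fun x hx => Finset.mem_range.2 (Nat.lt_succ_of_le (Finset.le_sup (f := id) hx))⟩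
  have h1 : cons ⁻¹' (Set.pi s t) = (t' 0) ×ˢ (Set.pi (Finset.range N) fun n => t' (n + 1)) := by
    ext ⟨a, x⟩
    simp only [Set.mem_preimage, Set.mem_pi, Set.mem_prod, ht', Finset.mem_coe, Finset.mem_range]
    constructor
    · intro h
      refine ⟨?_, fun n _ => ?_⟩
      · split_ifs with h0
        · exact h 0 h0
        · trivial
      · split_ifs with h0
        · exact h (n + 1) h0
        · trivial
    · rintro ⟨h0, h1⟩ n hn
      cases n with
      | zero => simpa [hn, cons] using h0
      | succ n =>
        have := h1 n (by have := Finset.mem_range.1 (hN hn); omega)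
        simpa [hn, cons] using this
  rw [Measure.map_apply measurable_cons (.pi s.countable_toSet fun n _ => ht n), h1,
    Measure.prod_prod, Measure.infinitePi_pi _ fun n _ => hmt' _,
    mul_comm, ← Finset.prod_range_succ' (fun n => ν (t' n)) N]
  rw [← Finset.prod_subset hN (f := fun n => ν (t' n))]
  · exact Finset.prod_congr rfl fun n hn => by simp [ht', hn]
  · intro n _ hn
    simp [ht', hn]

lemma measurePreserving_head_shift :
    MeasurePreserving (fun x : ℕ → β => (x 0, shift x)) (Measure.infinitePi fun _ : ℕ => ν)
      (ν.prod (Measure.infinitePi fun _ : ℕ => ν)) := by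
  refine ⟨by fun_prop, ?_⟩
  conv_lhs => rw [← map_cons_prod_infinitePi ν]
  rw [Measure.map_map (by fun_prop) measurable_cons]
  exact Measure.map_id

end Iid

section Linear

variable {d : ℕ}

lemma act_mul (A B : Matrix (Fin d) (Fin d) ℝ) (x : EuclideanSpace ℝ (Fin d)) :
    act (A * B) x = act A (act B x) := by
  simp [act, map_mul]

@[simp] lemma act_one (x : EuclideanSpace ℝ (Fin d)) : act 1 x = x := by
  simp [act]

lemma act_add (A : Matrix (Fin d) (Fin d) ℝ) (x y : EuclideanSpace ℝ (Fin d)) :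
    act A (x + y) = act A x + act A y := map_add _ _ _

lemma act_sub (A : Matrix (Fin d) (Fin d) ℝ) (x y : EuclideanSpace ℝ (Fin d)) :
    act A (x - y) = act A x - act A y := map_sub _ _ _

lemma act_smul (A : Matrix (Fin d) (Fin d) ℝ) (c : ℝ) (x : EuclideanSpace ℝ (Fin d)) :
    act A (c • x) = c • act A x := map_smul _ _ _

@[simp] lemma act_zero (A : Matrix (Fin d) (Fin d) ℝ) : act A 0 = 0 := map_zero _

lemma continuous_act (A : Matrix (Fin d) (Fin d) ℝ) : Continuous (act A) :=
  (Matrix.toEuclideanCLM (𝕜 := ℝ) A).continuous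

@[fun_prop]
lemma measurable_act (A : Matrix (Fin d) (Fin d) ℝ) : Measurable (act A) :=
  (continuous_act A).measurable

lemma inner_act_left {A : Matrix (Fin d) (Fin d) ℝ} (hA : A.IsHermitian)
    (x y : EuclideanSpace ℝ (Fin d)) : ⟪act A x, y⟫ = ⟪x, act A y⟫ := by
  have h : ContinuousLinearMap.adjoint (Matrix.toEuclideanCLM (𝕜 := ℝ) A) =
      Matrix.toEuclideanCLM (𝕜 := ℝ) A := by
    rw [← ContinuousLinearMap.star_eq_adjoint, ← map_star, Matrix.star_eq_conjTranspose, hA.eq]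
  rw [act, act, ← ContinuousLinearMap.adjoint_inner_left, h]

variable (V : Matrix (Fin d) (Fin d) ℝ)

lemma isHermitian_sqrt : (CFC.sqrt V).IsHermitian :=
  (Matrix.nonneg_iff_posSemidef.1 (CFC.sqrt_nonneg V)).isHermitian

variable {V}

lemma act_sqrt_sqrt (hV : V.PosSemidef) (x : EuclideanSpace ℝ (Fin d)) :
    act (CFC.sqrt V) (act (CFC.sqrt V) x) = act V x := by
  rw [← act_mul, CFC.sqrt_mul_sqrt_self _ hV.nonneg]

lemma inner_vecF (k : Fin d) (x : EuclideanSpace ℝ (Fin d)) :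
    ⟪vecF V k, x⟫ = act (CFC.sqrt V) x k := by
  rw [vecF, inner_act_left (isHermitian_sqrt V), EuclideanSpace.inner_single_left]
  simp

lemma norm_vecF (hV : V.PosSemidef) (hdiag : ∀ k, V k k = 1) (k : Fin d) : ‖vecF V k‖ = 1 := by
  have h : ⟪vecF V k, vecF V k⟫ = 1 := by
    rw [inner_vecF, vecF, act_sqrt_sqrt hV, act, Matrix.ofLp_toEuclideanCLM]
    simp [hdiag]
  rw [real_inner_self_eq_norm_sq] at h
  exact (pow_eq_one_iff_of_nonneg (norm_nonneg _) two_ne_zero).1 h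

lemma act_matP (k : Fin d) (x : EuclideanSpace ℝ (Fin d)) :
    act (matP V k) x = x - ⟪vecF V k, x⟫ • vecF V k := by
  ext j
  simp only [act, matP, Matrix.ofLp_toEuclideanCLM, Matrix.sub_mulVec, Matrix.one_mulVec,
    Matrix.vecMulVec_mulVec, PiLp.sub_apply, Pi.sub_apply, PiLp.smul_apply, smul_eq_mul]
  simp [PiLp.inner_apply, dotProduct, mul_comm]

lemma inner_act_matP (k : Fin d) (x y : EuclideanSpace ℝ (Fin d)) :
    ⟪x, act (matP V k) y⟫ = ⟪act (matP V k) x, y⟫ := by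
  simp only [act_matP, inner_sub_left, inner_sub_right, inner_smul_left, inner_smul_right,
    real_inner_comm x (vecF V k)]
  simp [mul_comm]

lemma norm_act_matP_sq (hV : V.PosSemidef) (hdiag : ∀ k, V k k = 1) (k : Fin d)
    (x : EuclideanSpace ℝ (Fin d)) :
    ‖act (matP V k) x‖ ^ 2 = ‖x‖ ^ 2 - ⟪vecF V k, x⟫ ^ 2 := by
  rw [act_matP, @norm_sub_sq_real, norm_smul, norm_vecF hV hdiag, inner_smul_right,
    real_inner_comm, Real.norm_eq_abs, mul_one, sq_abs]
  ring

lemma exists_sqrt_coercive (hV : V.PosDef) :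
    ∃ l : ℝ, 0 < l ∧ l ≤ 1 ∧
      ∀ x : EuclideanSpace ℝ (Fin d), l * ‖x‖ ^ 2 ≤ ‖act (CFC.sqrt V) x‖ ^ 2 := by
  set L := Matrix.toEuclideanCLM (𝕜 := ℝ) (V⁻¹ * CFC.sqrt V) with hL
  have hx (x : EuclideanSpace ℝ (Fin d)) : ‖x‖ ≤ ‖L‖ * ‖act (CFC.sqrt V) x‖ := by
    have h : L (act (CFC.sqrt V) x) = x := by
      change act _ _ = x
      rw [act_mul, act_sqrt_sqrt hV.posSemidef, ← act_mul,
        Matrix.nonsing_inv_mul _ ((Matrix.isUnit_iff_isUnit_det _).1 hV.isUnit), act_one]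
    calc ‖x‖ = ‖L (act (CFC.sqrt V) x)‖ := by rw [h]
      _ ≤ _ := L.le_opNorm _
  refine ⟨((‖L‖ + 1) ^ 2)⁻¹, by positivity, inv_le_one_of_one_le₀ ?_, fun x => ?_⟩
  · nlinarith [norm_nonneg L]
  · rw [inv_mul_le_iff₀ (by positivity), ← mul_pow]
    refine pow_le_pow_left₀ (norm_nonneg _) ((hx x).trans ?_) 2
    gcongr
    linarith

end Linear

section Recursion

variable {d : ℕ} (V : Matrix (Fin d) (Fin d) ℝ)

/-- One transition of the auxiliary chain, with index `k` and Gaussian input `t`. -/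
noncomputable def step (k : Fin d) (t : ℝ) (z : EuclideanSpace ℝ (Fin d)) :
    EuclideanSpace ℝ (Fin d) :=
  act (matP V k) z + t • vecF V k

lemma chainZ_zero (i : ℕ → Fin d) (g : ℕ → ℝ) (z : EuclideanSpace ℝ (Fin d)) :
    chainZ V i g z 0 = z := by
  simp [chainZ, chainY, matM]

lemma chainZ_succ (i : ℕ → Fin d) (g : ℕ → ℝ) (z : EuclideanSpace ℝ (Fin d)) (n : ℕ) :
    chainZ V i g z (n + 1) = step V (i n) (g n) (chainZ V i g z n) := by
  simp only [chainZ, chainY, matM, step, act_add, act_mul]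
  abel

lemma chainZ_succ' (i : ℕ → Fin d) (g : ℕ → ℝ) (z : EuclideanSpace ℝ (Fin d)) (n : ℕ) :
    chainZ V i g z (n + 1) = chainZ V (shift i) (shift g) (step V (i 0) (g 0) z) n := by
  induction n with
  | zero => rw [chainZ_succ, chainZ_zero, chainZ_zero]
  | succ n ih => rw [chainZ_succ, ih, chainZ_succ V (shift i)]; rfl

lemma chainZ_apply_zero (i : ℕ → Fin d) (g : ℕ → ℝ) (n : ℕ) :
    chainZ V i g 0 n = chainY V i g n := by
  simp [chainZ]

lemma matM_succ' (i : ℕ → Fin d) (n : ℕ) : matM V i (n + 1) = matM V (shift i) n * matP V (i 0) := by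
  induction n with
  | zero => simp [matM]
  | succ n ih => rw [matM, ih, matM, Matrix.mul_assoc]; rfl

variable {V} in
lemma chainX_eq (hV : V.PosSemidef) (i : ℕ → Fin d) (g : ℕ → ℝ) (n : ℕ) :
    chainX V i g n = act (CFC.sqrt V) (chainY V i g n) := by
  induction n with
  | zero => simp [chainX, chainY]
  | succ n ih =>
    have hf : act (CFC.sqrt V) (vecF V (i n)) = act V (EuclideanSpace.single (i n) 1) := by
      rw [vecF, act_sqrt_sqrt hV]
    rw [chainX, chainY, act_add, act_smul, act_matP, act_sub, act_smul, inner_vecF, hf, ih,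
      sub_smul]
    abel

lemma measurable_step :
    Measurable fun p : Fin d × ℝ × EuclideanSpace ℝ (Fin d) => step V p.1 p.2.1 p.2.2 := by
  refine measurable_from_prod_countable_right fun k => ?_
  change Measurable fun y : ℝ × EuclideanSpace ℝ (Fin d) => act (matP V k) y.2 + y.1 • vecF V k
  fun_prop

lemma measurable_step_comp {α : Type*} [MeasurableSpace α] {a : α → Fin d} {b : α → ℝ}
    {c : α → EuclideanSpace ℝ (Fin d)} (ha : Measurable a) (hb : Measurable b)
    (hc : Measurable c) : Measurable fun x => step V (a x) (b x) (c x) := by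
  have h := Measurable.prodMk ha (Measurable.prodMk hb hc)
  have h1 := Measurable.comp (measurable_step V) h
  exact h1

lemma measurable_chainZ (n : ℕ) :
    Measurable fun p : (ℕ → Fin d) × (ℕ → ℝ) × EuclideanSpace ℝ (Fin d) =>
      chainZ V p.1 p.2.1 p.2.2 n := by
  induction n with
  | zero =>
    simp only [chainZ_zero]
    fun_prop
  | succ n ih =>
    simp only [chainZ_succ]
    have h1 : Measurable fun p : (ℕ → Fin d) × (ℕ → ℝ) × EuclideanSpace ℝ (Fin d) => p.1 n := by
      fun_prop
    have h2 : Measurable fun p : (ℕ → Fin d) × (ℕ → ℝ) × EuclideanSpace ℝ (Fin d) => p.2.1 n := by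
      fun_prop
    exact measurable_step_comp V h1 h2 ih

end Recursion

section Stationary

variable {d : ℕ} {V : Matrix (Fin d) (Fin d) ℝ}

lemma measurePreserving_step (hV : V.PosSemidef) (hdiag : ∀ k, V k k = 1) (k : Fin d) :
    MeasurePreserving (fun p : ℝ × EuclideanSpace ℝ (Fin d) => step V k p.1 p.2)
      ((gaussianReal 0 1).prod (stdGaussian (EuclideanSpace ℝ (Fin d))))
      (stdGaussian (EuclideanSpace ℝ (Fin d))) := by
  have hm : Measurable fun p : ℝ × EuclideanSpace ℝ (Fin d) => step V k p.1 p.2 := by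
    unfold step; fun_prop
  refine ⟨hm, ?_⟩
  have := Measure.isProbabilityMeasure_map (μ := (gaussianReal 0 1).prod
    (stdGaussian (EuclideanSpace ℝ (Fin d)))) hm.aemeasurable
  refine Measure.ext_of_charFun ?_
  ext t
  rw [charFun_apply, integral_map hm.aemeasurable (by fun_prop)]
  have h (p : ℝ × EuclideanSpace ℝ (Fin d)) :
      Complex.exp (⟪step V k p.1 p.2, t⟫ * Complex.I) =
      Complex.exp (⟪p.1, ⟪vecF V k, t⟫⟫ * Complex.I) *
        Complex.exp (⟪p.2, act (matP V k) t⟫ * Complex.I) := by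
    rw [← Complex.exp_add, ← add_mul, step, inner_add_left, inner_smul_left, ← inner_act_matP]
    simp [add_comm, mul_comm]
  simp_rw [h]
  rw [integral_prod_mul (fun x : ℝ => Complex.exp (⟪x, ⟪vecF V k, t⟫⟫ * Complex.I))
    (fun x : EuclideanSpace ℝ (Fin d) => Complex.exp (⟪x, act (matP V k) t⟫ * Complex.I)),
    ← charFun_apply, ← charFun_apply, charFun_gaussianReal, charFun_stdGaussian,
    charFun_stdGaussian, ← Complex.exp_add]
  congr 1
  have := norm_act_matP_sq hV hdiag k t
  norm_cast
  rw [this]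
  push_cast
  simp
  ring

end Stationary

section Iid

variable {β γ δ : Type*} [MeasurableSpace β] [MeasurableSpace γ] [MeasurableSpace δ]

lemma measurePreserving_shift_prodMk (ν : Measure β) [IsProbabilityMeasure ν]
    {ξ : Measure γ} [SFinite ξ] {ξ' : Measure δ} [SFinite ξ'] {F : β → γ → δ}
    (hF : MeasurePreserving (fun p : β × γ => F p.1 p.2) (ν.prod ξ) ξ') :
    MeasurePreserving (fun p : (ℕ → β) × γ => (shift p.1, F (p.1 0) p.2))
      ((Measure.infinitePi fun _ : ℕ => ν).prod ξ) ((Measure.infinitePi fun _ : ℕ => ν).prod ξ') := by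
  have h1 := (measurePreserving_head_shift ν).prod (MeasurePreserving.id ξ)
  have h2 := (Measure.measurePreserving_swap (μ := ν)
    (ν := Measure.infinitePi fun _ : ℕ => ν)).prod (MeasurePreserving.id ξ)
  have h3 := measurePreserving_prodAssoc (Measure.infinitePi fun _ : ℕ => ν) ν ξ
  have h4 := (MeasurePreserving.id (Measure.infinitePi fun _ : ℕ => ν)).prod hF
  exact h4.comp (h3.comp (h2.comp h1))

end Iid

section Canonical

variable (d : ℕ)

/-- The law of the sequence of Gaussian inputs. -/
noncomputable def gaussSeq : Measure (ℕ → ℝ) := Measure.infinitePi fun _ => gaussianReal 0 1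

/-- The law of the sequence of indices. -/
noncomputable def indexSeq [NeZero d] : Measure (ℕ → Fin d) :=
  Measure.infinitePi fun _ => uniformOn Set.univ

instance : IsProbabilityMeasure gaussSeq := by unfold gaussSeq; infer_instance

instance [NeZero d] : IsProbabilityMeasure (indexSeq d) := by unfold indexSeq; infer_instance

/-- The joint law of the indices, the Gaussian inputs and the initial state. -/
noncomputable def inputLaw [NeZero d] :
    Measure ((ℕ → Fin d) × (ℕ → ℝ) × EuclideanSpace ℝ (Fin d)) :=
  (indexSeq d).prod (gaussSeq.prod (stdGaussian (EuclideanSpace ℝ (Fin d))))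

instance [NeZero d] : IsProbabilityMeasure (inputLaw d) := by unfold inputLaw; infer_instance

variable {d} (V : Matrix (Fin d) (Fin d) ℝ)

/-- Restarting the stationary chain after its first transition. -/
noncomputable def restart (p : (ℕ → Fin d) × (ℕ → ℝ) × EuclideanSpace ℝ (Fin d)) :
    (ℕ → Fin d) × (ℕ → ℝ) × EuclideanSpace ℝ (Fin d) :=
  (shift p.1, shift p.2.1, step V (p.1 0) (p.2.1 0) p.2.2)

lemma chainZ_add (p : (ℕ → Fin d) × (ℕ → ℝ) × EuclideanSpace ℝ (Fin d)) (j k : ℕ) :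
    chainZ V p.1 p.2.1 p.2.2 (j + k) =
      chainZ V ((restart V)^[j] p).1 ((restart V)^[j] p).2.1 ((restart V)^[j] p).2.2 k := by
  induction j generalizing p with
  | zero => simp
  | succ j ih =>
    rw [Function.iterate_succ_apply, ← ih, show j + 1 + k = j + k + 1 by omega, chainZ_succ']
    rfl

variable {V}

lemma measurePreserving_restart [NeZero d] (hV : V.PosSemidef) (hdiag : ∀ k, V k k = 1) :
    MeasurePreserving (restart V) (inputLaw d) (inputLaw d) := by
  have hs : MeasurePreserving shift (indexSeq d) (indexSeq d) :=
    measurePreserving_snd.comp (measurePreserving_head_shift _)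
  refine hs.skew_product (g := fun (i : ℕ → Fin d) (q : (ℕ → ℝ) × EuclideanSpace ℝ (Fin d)) =>
    (shift q.1, step V (i 0) (q.1 0) q.2)) ?_ (ae_of_all _ fun i => ?_)
  · have h1 : Measurable fun p : (ℕ → Fin d) × (ℕ → ℝ) × EuclideanSpace ℝ (Fin d) => p.1 0 := by
      fun_prop
    have h2 : Measurable fun p : (ℕ → Fin d) × (ℕ → ℝ) × EuclideanSpace ℝ (Fin d) => p.2.1 0 := by
      fun_prop
    have h3 : Measurable fun p : (ℕ → Fin d) × (ℕ → ℝ) × EuclideanSpace ℝ (Fin d) => p.2.2 := by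
      fun_prop
    have h4 : Measurable fun p : (ℕ → Fin d) × (ℕ → ℝ) × EuclideanSpace ℝ (Fin d) =>
      shift p.2.1 := by fun_prop
    exact h4.prodMk (measurable_step_comp V h1 h2 h3)
  · exact (measurePreserving_shift_prodMk _ (measurePreserving_step hV hdiag (i 0))).map_eq

end Canonical

section SecondMoment

variable {d : ℕ}

/-- `Y` is square integrable and centered with covariance at most the identity. -/
structure CenteredCovLEOne {Ω : Type*} [MeasurableSpace Ω] (Y : Ω → EuclideanSpace ℝ (Fin d))
    (P : Measure Ω) : Prop where
  memLp : MemLp Y 2 P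
  integral_eq : ∫ ω, Y ω ∂P = 0
  integral_inner_sq_le : ∀ u, ∫ ω, ⟪u, Y ω⟫ ^ 2 ∂P ≤ ‖u‖ ^ 2

variable {Ω Ω' : Type*} [MeasurableSpace Ω] [MeasurableSpace Ω'] {P : Measure Ω}

lemma centeredCovLEOne_map {f : Ω → Ω'} (hf : Measurable f)
    {Y : Ω' → EuclideanSpace ℝ (Fin d)} (hY : Measurable Y) :
    CenteredCovLEOne Y (P.map f) ↔ CenteredCovLEOne (fun ω => Y (f ω)) P := by
  have h1 := memLp_map_measure_iff (p := 2) (μ := P) hY.aestronglyMeasurable hf.aemeasurable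
  have h2 : ∫ ω, Y ω ∂(P.map f) = ∫ ω, Y (f ω) ∂P :=
    integral_map hf.aemeasurable hY.aestronglyMeasurable
  have h3 (u : EuclideanSpace ℝ (Fin d)) :
      ∫ ω, ⟪u, Y ω⟫ ^ 2 ∂(P.map f) = ∫ ω, ⟪u, Y (f ω)⟫ ^ 2 ∂P :=
    integral_map hf.aemeasurable (by fun_prop)
  exact ⟨fun h => ⟨h1.1 h.1, h2 ▸ h.2, fun u => h3 u ▸ h.3 u⟩,
    fun h => ⟨h1.2 h.1, h2 ▸ h.2, fun u => h3 u ▸ h.3 u⟩⟩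

variable {V : Matrix (Fin d) (Fin d) ℝ}

lemma memLp_two_gaussianReal : MemLp (fun x : ℝ => x) 2 (gaussianReal 0 1) :=
  memLp_id_gaussianReal 2

lemma integral_sq_gaussianReal : ∫ x : ℝ, x ^ 2 ∂(gaussianReal 0 1) = 1 := by
  have h := variance_of_integral_eq_zero (μ := gaussianReal 0 1) (X := fun x : ℝ => x)
    aemeasurable_id (by simp)
  rw [variance_fun_id_gaussianReal] at h
  simpa using h.symm

lemma CenteredCovLEOne.step [IsProbabilityMeasure P] (hV : V.PosSemidef)
    (hdiag : ∀ k, V k k = 1) (k : Fin d) {Y : Ω → EuclideanSpace ℝ (Fin d)}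
    (hY : CenteredCovLEOne Y P) :
    CenteredCovLEOne (fun q : ℝ × Ω => step V k q.1 (Y q.2)) ((gaussianReal 0 1).prod P) := by
  have hYq : MemLp (fun q : ℝ × Ω => Y q.2) 2 ((gaussianReal 0 1).prod P) :=
    hY.memLp.comp_measurePreserving measurePreserving_snd
  have hgq : MemLp (fun q : ℝ × Ω => q.1) 2 ((gaussianReal 0 1).prod P) :=
    memLp_two_gaussianReal.comp_measurePreserving measurePreserving_fst
  have hPY : MemLp (fun q : ℝ × Ω => act (matP V k) (Y q.2)) 2 ((gaussianReal 0 1).prod P) :=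
    (Matrix.toEuclideanCLM (𝕜 := ℝ) (matP V k)).comp_memLp' hYq
  have hgf : MemLp (fun q : ℝ × Ω => q.1 • vecF V k) 2 ((gaussianReal 0 1).prod P) := by
    have := ((ContinuousLinearMap.id ℝ ℝ).smulRight (vecF V k)).comp_memLp' hgq
    exact this
  refine ⟨hPY.add hgf, ?_, fun u => ?_⟩
  · simp only [GaussSim.step]
    rw [integral_add (hPY.integrable (by norm_num)) (hgf.integrable (by norm_num)),
      integral_smul_const, integral_fun_fst (fun x : ℝ => x),
      integral_fun_snd (fun ω => act (matP V k) (Y ω))]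
    have : ∫ ω, act (matP V k) (Y ω) ∂P = 0 := by
      have := (Matrix.toEuclideanCLM (𝕜 := ℝ) (matP V k)).integral_comp_comm
        (hY.memLp.integrable (by norm_num))
      rw [hY.integral_eq, map_zero] at this
      exact this
    simp [this]
  · have e (q : ℝ × Ω) : ⟪u, GaussSim.step V k q.1 (Y q.2)⟫ ^ 2 =
        ⟪act (matP V k) u, Y q.2⟫ ^ 2 + q.1 ^ 2 * ⟪vecF V k, u⟫ ^ 2 +
          2 * ⟪vecF V k, u⟫ * (q.1 * ⟪act (matP V k) u, Y q.2⟫) := by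
      rw [GaussSim.step, inner_add_right, inner_smul_right, inner_act_matP,
        real_inner_comm (vecF V k)]
      ring
    have hi : MemLp (fun q : ℝ × Ω => ⟪act (matP V k) u, Y q.2⟫) 2
        ((gaussianReal 0 1).prod P) := hYq.const_inner _
    have i1 : Integrable (fun q : ℝ × Ω => q.1 ^ 2 * ⟪vecF V k, u⟫ ^ 2)
        ((gaussianReal 0 1).prod P) := hgq.integrable_sq.mul_const _
    have i2 : Integrable (fun q : ℝ × Ω => 2 * ⟪vecF V k, u⟫ *
        (q.1 * ⟪act (matP V k) u, Y q.2⟫)) ((gaussianReal 0 1).prod P) :=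
      (hgq.integrable_mul hi).const_mul _
    have i3 : Integrable (fun q : ℝ × Ω => ⟪act (matP V k) u, Y q.2⟫ ^ 2 +
        q.1 ^ 2 * ⟪vecF V k, u⟫ ^ 2) ((gaussianReal 0 1).prod P) := hi.integrable_sq.add i1
    simp_rw [e]
    rw [integral_add i3 i2, integral_add hi.integrable_sq i1, integral_const_mul,
      integral_mul_const, integral_fun_fst (fun x : ℝ => x ^ 2), integral_sq_gaussianReal,
      integral_fun_snd (fun ω => ⟪act (matP V k) u, Y ω⟫ ^ 2),
      integral_prod_mul (fun x : ℝ => x) (fun ω => ⟪act (matP V k) u, Y ω⟫)]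
    have h1 := hY.integral_inner_sq_le (act (matP V k) u)
    rw [norm_act_matP_sq hV hdiag] at h1
    simp
    linarith

lemma CenteredCovLEOne.posSemidef_sub_covMat (hV : V.PosSemidef)
    {Y : Ω → EuclideanSpace ℝ (Fin d)} (hY : CenteredCovLEOne Y P) :
    (V - covMat (fun ω => act (CFC.sqrt V) (Y ω)) P).PosSemidef := by
  have hm : MemLp (fun ω => act (CFC.sqrt V) (Y ω)) 2 P :=
    (Matrix.toEuclideanCLM (𝕜 := ℝ) (CFC.sqrt V)).comp_memLp' hY.memLp
  have hmk (k : Fin d) : MemLp (fun ω => act (CFC.sqrt V) (Y ω) k) 2 P := by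
    have := (EuclideanSpace.proj (𝕜 := ℝ) k).comp_memLp' hm
    exact this
  refine .of_dotProduct_mulVec_nonneg (hV.isHermitian.sub ?_) fun x => ?_
  · ext k l
    simp [covMat, mul_comm]
  · have h1 : x ⬝ᵥ covMat (fun ω => act (CFC.sqrt V) (Y ω)) P *ᵥ x =
        ∫ ω, ⟪act (CFC.sqrt V) (WithLp.toLp 2 x), Y ω⟫ ^ 2 ∂P := by
      have e (ω : Ω) : ⟪act (CFC.sqrt V) (WithLp.toLp 2 x), Y ω⟫ ^ 2 =
          ∑ k, ∑ l, x k * x l * (act (CFC.sqrt V) (Y ω) k * act (CFC.sqrt V) (Y ω) l) := by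
        rw [inner_act_left (isHermitian_sqrt V), PiLp.inner_apply, sq, Finset.sum_mul_sum]
        refine Finset.sum_congr rfl fun k _ => Finset.sum_congr rfl fun l _ => ?_
        simp
        ring
      have hi (k l : Fin d) : Integrable (fun ω => x k * x l *
          (act (CFC.sqrt V) (Y ω) k * act (CFC.sqrt V) (Y ω) l)) P :=
        ((hmk k).integrable_mul (hmk l)).const_mul _
      simp_rw [e]
      rw [integral_finsetSum _ fun k _ => integrable_finsetSum _ fun l _ => hi k l]
      simp only [dotProduct, Matrix.mulVec, Finset.mul_sum]
      refine Finset.sum_congr rfl fun k _ => ?_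
      rw [integral_finsetSum _ fun l _ => hi k l]
      refine Finset.sum_congr rfl fun l _ => ?_
      rw [integral_const_mul, covMat, Matrix.of_apply]
      ring
    have h2 : x ⬝ᵥ V *ᵥ x = ‖act (CFC.sqrt V) (WithLp.toLp 2 x)‖ ^ 2 := by
      rw [← real_inner_self_eq_norm_sq, inner_act_left (isHermitian_sqrt V), act_sqrt_sqrt hV,
        act, Matrix.inner_toEuclideanCLM]
    have := hY.integral_inner_sq_le (act (CFC.sqrt V) (WithLp.toLp 2 x))
    simp only [star_trivial, Matrix.sub_mulVec, dotProduct_sub, h1, h2]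
    linarith

end SecondMoment

section PairLaw

variable {d : ℕ} {V : Matrix (Fin d) (Fin d) ℝ}

/-- A Gaussian law of a pair of centered vectors with covariances at most the identity. -/
structure IsGaussianPairLEOne
    (ν : Measure (EuclideanSpace ℝ (Fin d) × EuclideanSpace ℝ (Fin d))) : Prop where
  isGaussian : IsGaussian ν
  fst : CenteredCovLEOne Prod.fst ν
  snd : CenteredCovLEOne Prod.snd ν

variable {ν : Measure (EuclideanSpace ℝ (Fin d) × EuclideanSpace ℝ (Fin d))}

/-- One transition of two auxiliary chains driven by the same input. -/
noncomputable def stepPair (V : Matrix (Fin d) (Fin d) ℝ) (k : Fin d) (t : ℝ)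
    (y : EuclideanSpace ℝ (Fin d) × EuclideanSpace ℝ (Fin d)) :
    EuclideanSpace ℝ (Fin d) × EuclideanSpace ℝ (Fin d) :=
  (step V k t y.1, step V k t y.2)

/-- `stepPair` as a continuous linear map of the input and the pair of states. -/
noncomputable def stepPairL (V : Matrix (Fin d) (Fin d) ℝ) (k : Fin d) :
    ℝ × EuclideanSpace ℝ (Fin d) × EuclideanSpace ℝ (Fin d) →L[ℝ]
      EuclideanSpace ℝ (Fin d) × EuclideanSpace ℝ (Fin d) :=
  let A := Matrix.toEuclideanCLM (𝕜 := ℝ) (matP V k)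
  let f := (ContinuousLinearMap.fst ℝ ℝ (EuclideanSpace ℝ (Fin d) ×
    EuclideanSpace ℝ (Fin d))).smulRight (vecF V k)
  let s := ContinuousLinearMap.snd ℝ ℝ (EuclideanSpace ℝ (Fin d) × EuclideanSpace ℝ (Fin d))
  (A ∘L (ContinuousLinearMap.fst ℝ _ _) ∘L s + f).prod
    (A ∘L (ContinuousLinearMap.snd ℝ _ _) ∘L s + f)

lemma IsGaussianPairLEOne.map_stepPair (hV : V.PosSemidef) (hdiag : ∀ k, V k k = 1) (k : Fin d)
    (h : IsGaussianPairLEOne ν) :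
    IsGaussianPairLEOne (((gaussianReal 0 1).prod ν).map fun q => stepPair V k q.1 q.2) := by
  have := h.isGaussian
  have hm : Measurable fun q : ℝ × EuclideanSpace ℝ (Fin d) × EuclideanSpace ℝ (Fin d) =>
      stepPair V k q.1 q.2 := (stepPairL V k).continuous.measurable
  refine ⟨isGaussian_map (stepPairL V k), ?_, ?_⟩
  · rw [centeredCovLEOne_map hm measurable_fst]
    exact h.fst.step hV hdiag k
  · rw [centeredCovLEOne_map hm measurable_snd]
    exact h.snd.step hV hdiag k

lemma measurable_chainZ_pair (i : ℕ → Fin d) (n : ℕ) :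
    Measurable fun q : (ℕ → ℝ) × EuclideanSpace ℝ (Fin d) × EuclideanSpace ℝ (Fin d) =>
      (chainZ V i q.1 q.2.1 n, chainZ V i q.1 q.2.2 n) := by
  have h1 : Measurable fun q : (ℕ → ℝ) × EuclideanSpace ℝ (Fin d) × EuclideanSpace ℝ (Fin d) =>
      (i, q.1, q.2.1) := by fun_prop
  have h2 : Measurable fun q : (ℕ → ℝ) × EuclideanSpace ℝ (Fin d) × EuclideanSpace ℝ (Fin d) =>
      (i, q.1, q.2.2) := by fun_prop
  have h3 := Measurable.comp (measurable_chainZ V n) h1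
  have h4 := Measurable.comp (measurable_chainZ V n) h2
  exact h3.prodMk h4

lemma IsGaussianPairLEOne.map_chainZ (hV : V.PosSemidef) (hdiag : ∀ k, V k k = 1) (n : ℕ)
    (i : ℕ → Fin d) (h : IsGaussianPairLEOne ν) :
    IsGaussianPairLEOne ((gaussSeq.prod ν).map fun q =>
      (chainZ V i q.1 q.2.1 n, chainZ V i q.1 q.2.2 n)) := by
  induction n generalizing i ν with
  | zero =>
    have := h.isGaussian
    simp only [chainZ_zero, Prod.mk.eta]
    rw [measurePreserving_snd.map_eq]
    exact h
  | succ n ih =>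
    have := h.isGaussian
    have h' := h.map_stepPair hV hdiag (i 0)
    have := h'.isGaussian
    have hm : Measurable fun q : ℝ × EuclideanSpace ℝ (Fin d) × EuclideanSpace ℝ (Fin d) =>
        stepPair V (i 0) q.1 q.2 := (stepPairL V (i 0)).continuous.measurable
    have hp := measurePreserving_shift_prodMk (gaussianReal 0 1) (F := stepPair V (i 0))
      (hm.measurePreserving ((gaussianReal 0 1).prod ν))
    have hr := ih (shift i) h'
    unfold gaussSeq at hr
    rw [← hp.map_eq, Measure.map_map (measurable_chainZ_pair _ _) hp.measurable] at hr
    simp only [chainZ_succ']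
    exact hr

lemma centeredCovLEOne_stdGaussian :
    CenteredCovLEOne (fun x => x) (stdGaussian (EuclideanSpace ℝ (Fin d))) := by
  refine ⟨IsGaussian.memLp_two_id, integral_id_stdGaussian, fun u => le_of_eq ?_⟩
  have h := variance_dual_stdGaussian (innerSL ℝ u)
  rw [variance_of_integral_eq_zero (by fun_prop) (integral_strongDual_stdGaussian _)] at h
  simpa using h

lemma isGaussianPairLEOne_zero_stdGaussian :
    IsGaussianPairLEOne ((stdGaussian (EuclideanSpace ℝ (Fin d))).map
      fun z => ((0 : EuclideanSpace ℝ (Fin d)), z)) := by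
  have hm : Measurable fun z : EuclideanSpace ℝ (Fin d) => ((0 : EuclideanSpace ℝ (Fin d)), z) := by
    fun_prop
  refine ⟨isGaussian_map (ContinuousLinearMap.inr ℝ (EuclideanSpace ℝ (Fin d))
    (EuclideanSpace ℝ (Fin d))), ?_, ?_⟩
  · rw [centeredCovLEOne_map hm measurable_fst]
    refine ⟨by simp, by simp, fun u => by simp⟩
  · rw [centeredCovLEOne_map hm measurable_snd]
    exact centeredCovLEOne_stdGaussian

lemma isGaussianPairLEOne_chainY_chainZ (hV : V.PosSemidef) (hdiag : ∀ k, V k k = 1) (n : ℕ)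
    (i : ℕ → Fin d) :
    IsGaussianPairLEOne ((gaussSeq.prod (stdGaussian (EuclideanSpace ℝ (Fin d)))).map fun q =>
      (chainY V i q.1 n, chainZ V i q.1 q.2 n)) := by
  have h := (isGaussianPairLEOne_zero_stdGaussian (d := d)).map_chainZ hV hdiag n i
  have hm : Measurable fun z : EuclideanSpace ℝ (Fin d) => ((0 : EuclideanSpace ℝ (Fin d)), z) := by
    fun_prop
  have hp := (MeasurePreserving.id gaussSeq).prod
    (hm.measurePreserving (stdGaussian (EuclideanSpace ℝ (Fin d))))
  rw [← hp.map_eq, Measure.map_map (measurable_chainZ_pair _ _) hp.measurable] at h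
  convert h using 2
  ext1 q
  simp [chainZ_apply_zero]

variable {κ γ : ℝ} {h : EuclideanSpace ℝ (Fin d) → ℝ}

lemma IsGaussLipschitz.lintegral_le (hh : IsGaussLipschitz κ γ V h) (hV : V.PosSemidef)
    (hν : IsGaussianPairLEOne ν) :
    ∫⁻ p, ENNReal.ofReal ((h (act (CFC.sqrt V) p.1) - h (act (CFC.sqrt V) p.2)) ^ 2) ∂ν ≤
      ENNReal.ofReal (κ ^ 2 * (∫ p, ‖act (CFC.sqrt V) p.1 - act (CFC.sqrt V) p.2‖ ^ 2 ∂ν) ^ γ) := by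
  have := hν.isGaussian
  set S := Matrix.toEuclideanCLM (𝕜 := ℝ) (CFC.sqrt V) with hS
  have hSm : Measurable (S.prodMap S) := (S.prodMap S).continuous.measurable
  have hhm := hh.1
  have key := hh.2 (ν.map (S.prodMap S)) inferInstance ?_ ?_ ?_
  · rw [lintegral_map (by fun_prop) hSm, integral_map hSm.aemeasurable (by fun_prop)] at key
    exact key
  · have hi : Integrable (fun p : EuclideanSpace ℝ (Fin d) × EuclideanSpace ℝ (Fin d) => p) ν :=
      IsGaussian.integrable_id
    have h0 : ∫ p, p ∂ν = 0 := by
      refine Prod.ext ?_ ?_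
      · rw [fst_integral hi]; exact hν.fst.integral_eq
      · rw [snd_integral hi]; exact hν.snd.integral_eq
    rw [integral_map hSm.aemeasurable (by fun_prop), (S.prodMap S).integral_comp_comm hi, h0,
      map_zero]
  · convert hν.fst.posSemidef_sub_covMat hV using 2
    ext k l
    simp only [covMat, Matrix.of_apply]
    rw [integral_map hSm.aemeasurable (by fun_prop)]
    rfl
  · convert hν.snd.posSemidef_sub_covMat hV using 2
    ext k l
    simp only [covMat, Matrix.of_apply]
    rw [integral_map hSm.aemeasurable (by fun_prop)]
    rfl

end PairLaw

lemma lintegral_rpow_le_rpow_lintegral {α : Type*} [MeasurableSpace α] (μ : Measure α)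
    [IsProbabilityMeasure μ] {f : α → ℝ≥0∞} (hf : Measurable f) {γ : ℝ} (h0 : 0 < γ)
    (h1 : γ ≤ 1) : ∫⁻ x, f x ^ γ ∂μ ≤ (∫⁻ x, f x ∂μ) ^ γ := by
  have h := eLpNorm'_le_eLpNorm'_of_exponent_le h0 h1 μ hf.aestronglyMeasurable
  simp only [eLpNorm', enorm_eq_self, ENNReal.rpow_one, one_div, inv_one] at h
  have := ENNReal.rpow_le_rpow h h0.le
  rwa [← ENNReal.rpow_mul, inv_mul_cancel₀ h0.ne', ENNReal.rpow_one] at this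

section Contraction

variable {d : ℕ} {V : Matrix (Fin d) (Fin d) ℝ}

lemma act_matM (i : ℕ → Fin d) (z : EuclideanSpace ℝ (Fin d)) (n : ℕ) :
    act (matM V i n) z = chainZ V i 0 z n := by
  induction n with
  | zero => simp [chainZ_zero, matM]
  | succ n ih => rw [matM, act_mul, ih, chainZ_succ]; simp [step]

lemma chainZ_sub_chainY (i : ℕ → Fin d) (g : ℕ → ℝ) (z : EuclideanSpace ℝ (Fin d)) (n : ℕ) :
    chainZ V i g z n - chainY V i g n = act (matM V i n) z := by
  simp [chainZ]

lemma measurable_act_matM (n : ℕ) :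
    Measurable fun p : (ℕ → Fin d) × EuclideanSpace ℝ (Fin d) => act (matM V p.1 n) p.2 := by
  have h : Measurable fun p : (ℕ → Fin d) × EuclideanSpace ℝ (Fin d) =>
      (p.1, (0 : ℕ → ℝ), p.2) := by fun_prop
  have := Measurable.comp (measurable_chainZ V n) h
  simp only [act_matM]
  exact this

lemma measurable_ofReal_norm_act_matM_sq (n : ℕ) (z : EuclideanSpace ℝ (Fin d)) :
    Measurable fun i : ℕ → Fin d => ENNReal.ofReal (‖act (matM V i n) z‖ ^ 2) := by
  have h1 : Measurable fun i : ℕ → Fin d => (i, z) := measurable_prodMk_right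
  have h2 := Measurable.comp (measurable_act_matM (V := V) n) h1
  exact ENNReal.measurable_ofReal.comp (h2.norm.pow_const 2)

variable [NeZero d]

lemma lintegral_norm_act_matP_sq_le (hV : V.PosSemidef) (hdiag : ∀ k, V k k = 1) {l : ℝ}
    (hl : ∀ x : EuclideanSpace ℝ (Fin d), l * ‖x‖ ^ 2 ≤ ‖act (CFC.sqrt V) x‖ ^ 2)
    (z : EuclideanSpace ℝ (Fin d)) :
    ∫⁻ k, ENNReal.ofReal (‖act (matP V k) z‖ ^ 2) ∂(uniformOn (Set.univ : Set (Fin d))) ≤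
      ENNReal.ofReal ((1 - l / d) * ‖z‖ ^ 2) := by
  have hd : (0 : ℝ) < d := Nat.cast_pos.2 (NeZero.pos d)
  have h1 (k : Fin d) : uniformOn (Set.univ : Set (Fin d)) {k} = ENNReal.ofReal (d : ℝ)⁻¹ := by
    rw [uniformOn_univ, Measure.count_singleton, Fintype.card_fin, one_div,
      ENNReal.ofReal_inv_of_pos hd, ENNReal.ofReal_natCast]
  rw [lintegral_fintype]
  simp_rw [h1, ← ENNReal.ofReal_mul (sq_nonneg ‖act (matP V _) z‖)]
  rw [← ENNReal.ofReal_sum_of_nonneg fun k _ => by positivity]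
  refine ENNReal.ofReal_le_ofReal ?_
  have h2 : ∑ k : Fin d, ⟪vecF V k, z⟫ ^ 2 = ‖act (CFC.sqrt V) z‖ ^ 2 := by
    rw [EuclideanSpace.real_norm_sq_eq]
    simp only [inner_vecF]
  rw [← Finset.sum_mul]
  simp only [norm_act_matP_sq hV hdiag, Finset.sum_sub_distrib, h2, Finset.sum_const,
    Finset.card_univ, Fintype.card_fin, nsmul_eq_mul]
  rw [← div_eq_mul_inv, div_le_iff₀ hd]
  have := hl z
  field_simp
  linarith

lemma lintegral_norm_act_matM_sq_le (hV : V.PosSemidef) (hdiag : ∀ k, V k k = 1) {l : ℝ}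
    (hl : ∀ x : EuclideanSpace ℝ (Fin d), l * ‖x‖ ^ 2 ≤ ‖act (CFC.sqrt V) x‖ ^ 2)
    (hl1 : 0 ≤ 1 - l / d) (n : ℕ) (z : EuclideanSpace ℝ (Fin d)) :
    ∫⁻ i, ENNReal.ofReal (‖act (matM V i n) z‖ ^ 2) ∂(indexSeq d) ≤
      ENNReal.ofReal ((1 - l / d) ^ n * ‖z‖ ^ 2) := by
  induction n generalizing z with
  | zero => simp [matM]
  | succ n ih =>
    have hp := measurePreserving_head_shift (uniformOn (Set.univ : Set (Fin d)))
    have hm : Measurable fun q : Fin d × (ℕ → Fin d) =>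
        ENNReal.ofReal (‖act (matM V q.2 n) (act (matP V q.1) z)‖ ^ 2) := by
      refine measurable_from_prod_countable_right fun k => ?_
      exact measurable_ofReal_norm_act_matM_sq n (act (matP V k) z)
    have h2 := hp.lintegral_comp hm
    have h3 : ∫⁻ i, ENNReal.ofReal (‖act (matM V i (n + 1)) z‖ ^ 2) ∂(indexSeq d) =
        ∫⁻ k, ∫⁻ i, ENNReal.ofReal (‖act (matM V i n) (act (matP V k) z)‖ ^ 2) ∂(indexSeq d)
          ∂(uniformOn (Set.univ : Set (Fin d))) := by
      simp only [matM_succ', act_mul]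
      rw [indexSeq, ← lintegral_prod (fun q : Fin d × (ℕ → Fin d) =>
        ENNReal.ofReal (‖act (matM V q.2 n) (act (matP V q.1) z)‖ ^ 2)) hm.aemeasurable]
      exact h2
    rw [h3]
    calc _ ≤ ∫⁻ k, ENNReal.ofReal ((1 - l / d) ^ n) * ENNReal.ofReal (‖act (matP V k) z‖ ^ 2)
            ∂(uniformOn (Set.univ : Set (Fin d))) := by
          refine lintegral_mono fun k => ?_
          rw [← ENNReal.ofReal_mul (by positivity)]
          exact ih _
      _ ≤ ENNReal.ofReal ((1 - l / d) ^ n) * ENNReal.ofReal ((1 - l / d) * ‖z‖ ^ 2) := by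
          rw [lintegral_const_mul _ (measurable_of_countable _)]
          gcongr
          exact lintegral_norm_act_matP_sq_le hV hdiag hl z
      _ = _ := by
          rw [← ENNReal.ofReal_mul (by positivity)]
          congr 1
          ring

end Contraction

section Coupling

variable {d : ℕ} {V : Matrix (Fin d) (Fin d) ℝ} {κ γ : ℝ}
  {h : EuclideanSpace ℝ (Fin d) → ℝ}

theorem exists_lintegral_sub_sq_le [NeZero d] (hV : V.PosDef) (hdiag : ∀ k, V k k = 1)
    (hγ0 : 0 < γ) (hγ1 : γ ≤ 1) (hh : IsGaussLipschitz κ γ V h) :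
    ∃ C r : ℝ, 0 ≤ C ∧ 0 ≤ r ∧ r < 1 ∧ ∀ n : ℕ,
      ∫⁻ p, ENNReal.ofReal ((h (act (CFC.sqrt V) (chainY V p.1 p.2.1 n)) -
        h (act (CFC.sqrt V) (chainZ V p.1 p.2.1 p.2.2 n))) ^ 2) ∂(inputLaw d) ≤
      ENNReal.ofReal (C * r ^ n) := by
  obtain ⟨l, hl0, hl1, hl⟩ := exists_sqrt_coercive hV
  have hd : (1 : ℝ) ≤ d := Nat.one_le_cast.2 (NeZero.pos d)
  have hρ0 : 0 ≤ 1 - l / d := by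
    rw [sub_nonneg, div_le_one (by linarith)]
    linarith
  have hρ1 : 1 - l / d < 1 := by
    have : 0 < l / d := by positivity
    linarith
  set ρ := 1 - l / d with hρ
  set S := Matrix.toEuclideanCLM (𝕜 := ℝ) (CFC.sqrt V) with hS
  set c : ℝ := ∫ z, ‖S‖ ^ 2 * ‖z‖ ^ 2 ∂(stdGaussian (EuclideanSpace ℝ (Fin d))) with hc
  have hc0 : 0 ≤ c := integral_nonneg fun z => by positivity
  have hcl : ∫⁻ z, ENNReal.ofReal (‖S‖ ^ 2 * ‖z‖ ^ 2)
      ∂(stdGaussian (EuclideanSpace ℝ (Fin d))) = ENNReal.ofReal c := by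
    rw [hc, ofReal_integral_eq_lintegral_ofReal _ (ae_of_all _ fun z => by positivity)]
    have hm : MemLp (fun z : EuclideanSpace ℝ (Fin d) => z) 2
        (stdGaussian (EuclideanSpace ℝ (Fin d))) := IsGaussian.memLp_two_id
    exact (hm.norm.integrable_sq).const_mul _
  set G : ℕ → (ℕ → Fin d) × EuclideanSpace ℝ (Fin d) → ℝ≥0∞ := fun n p =>
    ENNReal.ofReal (‖S‖ ^ 2 * ‖act (matM V p.1 n) p.2‖ ^ 2) with hG
  have hGm (n : ℕ) : Measurable (G n) :=
    ENNReal.measurable_ofReal.comp (((measurable_act_matM n).norm.pow_const 2).const_mul _)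
  have hGint (n : ℕ) : ∫⁻ i, ∫⁻ z, G n (i, z) ∂(stdGaussian (EuclideanSpace ℝ (Fin d)))
      ∂(indexSeq d) ≤ ENNReal.ofReal (ρ ^ n * c) := by
    rw [lintegral_lintegral_swap (f := fun i z => G n (i, z)) (hGm n).aemeasurable]
    calc _ ≤ ∫⁻ z, ENNReal.ofReal (ρ ^ n) * ENNReal.ofReal (‖S‖ ^ 2 * ‖z‖ ^ 2)
            ∂(stdGaussian (EuclideanSpace ℝ (Fin d))) := by
          refine lintegral_mono fun z => ?_
          simp only [hG, ENNReal.ofReal_mul (sq_nonneg ‖S‖)]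
          rw [lintegral_const_mul _ (measurable_ofReal_norm_act_matM_sq n z), mul_left_comm, ← ENNReal.ofReal_mul (by positivity)]
          gcongr
          exact lintegral_norm_act_matM_sq_le hV.posSemidef hdiag hl hρ0 n z
      _ = _ := by
          rw [lintegral_const_mul _ (by fun_prop), hcl, ← ENNReal.ofReal_mul (by positivity)]
  refine ⟨κ ^ 2 * c ^ γ, ρ ^ γ, by positivity, by positivity,
    Real.rpow_lt_one hρ0 hρ1 hγ0, fun n => ?_⟩
  have hpairm : Measurable fun p : (ℕ → Fin d) × (ℕ → ℝ) × EuclideanSpace ℝ (Fin d) =>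
      (chainY V p.1 p.2.1 n, chainZ V p.1 p.2.1 p.2.2 n) := by
    have h1 : Measurable fun p : (ℕ → Fin d) × (ℕ → ℝ) × EuclideanSpace ℝ (Fin d) =>
      (p.1, p.2.1, (0 : EuclideanSpace ℝ (Fin d))) := by fun_prop
    have h2 := Measurable.comp (measurable_chainZ V n) h1
    simp only [Function.comp_def, chainZ_apply_zero] at h2
    exact h2.prodMk (measurable_chainZ V n)
  have hHm : Measurable fun q : EuclideanSpace ℝ (Fin d) × EuclideanSpace ℝ (Fin d) =>
      ENNReal.ofReal ((h (act (CFC.sqrt V) q.1) - h (act (CFC.sqrt V) q.2)) ^ 2) := by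
    have := hh.1
    fun_prop
  have hfix (i : ℕ → Fin d) :
      ∫⁻ q : (ℕ → ℝ) × EuclideanSpace ℝ (Fin d),
        ENNReal.ofReal ((h (act (CFC.sqrt V) (chainY V i q.1 n)) -
          h (act (CFC.sqrt V) (chainZ V i q.1 q.2 n))) ^ 2)
        ∂(gaussSeq.prod (stdGaussian (EuclideanSpace ℝ (Fin d)))) ≤
      ENNReal.ofReal (κ ^ 2) *
        (∫⁻ z, G n (i, z) ∂(stdGaussian (EuclideanSpace ℝ (Fin d)))) ^ γ := by
    have hm : Measurable fun q : (ℕ → ℝ) × EuclideanSpace ℝ (Fin d) =>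
        (chainY V i q.1 n, chainZ V i q.1 q.2 n) := by
      have h1 : Measurable fun q : (ℕ → ℝ) × EuclideanSpace ℝ (Fin d) => (i, q) := by fun_prop
      exact Measurable.comp hpairm h1
    have key := hh.lintegral_le hV.posSemidef
      (isGaussianPairLEOne_chainY_chainZ hV.posSemidef hdiag n i)
    rw [lintegral_map hHm hm, integral_map hm.aemeasurable (by fun_prop)] at key
    refine key.trans ?_
    set D := ∫ q : (ℕ → ℝ) × EuclideanSpace ℝ (Fin d),
      ‖act (CFC.sqrt V) (chainY V i q.1 n) - act (CFC.sqrt V) (chainZ V i q.1 q.2 n)‖ ^ 2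
        ∂(gaussSeq.prod (stdGaussian (EuclideanSpace ℝ (Fin d)))) with hD
    have hDle : D = ∫ z, ‖act (CFC.sqrt V) (act (matM V i n) z)‖ ^ 2
        ∂(stdGaussian (EuclideanSpace ℝ (Fin d))) := by
      have e (q : (ℕ → ℝ) × EuclideanSpace ℝ (Fin d)) :
          ‖act (CFC.sqrt V) (chainY V i q.1 n) - act (CFC.sqrt V) (chainZ V i q.1 q.2 n)‖ ^ 2 =
            ‖act (CFC.sqrt V) (act (matM V i n) q.2)‖ ^ 2 := by
        rw [norm_sub_rev, ← act_sub, chainZ_sub_chainY]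
      simp_rw [hD, e]
      rw [integral_fun_snd (fun z => ‖act (CFC.sqrt V) (act (matM V i n) z)‖ ^ 2)]
      simp
    have hD0 : 0 ≤ D := integral_nonneg fun q => by positivity
    rw [ENNReal.ofReal_mul (sq_nonneg κ), ← ENNReal.ofReal_rpow_of_nonneg hD0 hγ0.le]
    gcongr
    rw [hDle, integral_eq_lintegral_of_nonneg_ae (ae_of_all _ fun z => by positivity)
      (Measurable.aestronglyMeasurable (by fun_prop))]
    refine ENNReal.ofReal_toReal_le.trans (lintegral_mono fun z => ENNReal.ofReal_le_ofReal ?_)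
    rw [← mul_pow]
    exact pow_le_pow_left₀ (norm_nonneg _) (S.le_opNorm _) 2
  have hFm := Measurable.comp hHm hpairm
  simp only [Function.comp_def] at hFm
  rw [inputLaw, lintegral_prod _ hFm.aemeasurable]
  have hIm : Measurable fun i : ℕ → Fin d =>
      ∫⁻ z, G n (i, z) ∂(stdGaussian (EuclideanSpace ℝ (Fin d))) :=
    (hGm n).lintegral_prod_right'
  calc _ ≤ ∫⁻ i, ENNReal.ofReal (κ ^ 2) *
        (∫⁻ z, G n (i, z) ∂(stdGaussian (EuclideanSpace ℝ (Fin d)))) ^ γ ∂(indexSeq d) :=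
        lintegral_mono hfix
    _ ≤ ENNReal.ofReal (κ ^ 2) * ENNReal.ofReal (ρ ^ n * c) ^ γ := by
        rw [lintegral_const_mul _ (hIm.pow_const γ)]
        gcongr
        exact (lintegral_rpow_le_rpow_lintegral _ hIm hγ0 hγ1).trans
          (ENNReal.rpow_le_rpow (hGint n) hγ0.le)
    _ = _ := by
        have e : (ρ ^ n) ^ γ = (ρ ^ γ) ^ n := by
          rw [← Real.rpow_natCast_mul hρ0, mul_comm, Real.rpow_mul_natCast hρ0]
        rw [ENNReal.ofReal_rpow_of_nonneg (by positivity) hγ0.le,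
          ← ENNReal.ofReal_mul (sq_nonneg κ), Real.mul_rpow (by positivity) hc0, e]
        congr 1
        ring

lemma memLp_comp_sqrt (hV : V.PosSemidef) (hh : IsGaussLipschitz κ γ V h) :
    MemLp (fun z => h (act (CFC.sqrt V) z)) 2 (stdGaussian (EuclideanSpace ℝ (Fin d))) := by
  have key := hh.lintegral_le hV (isGaussianPairLEOne_zero_stdGaussian (d := d))
  have hhm := hh.1
  rw [lintegral_map (by fun_prop) (by fun_prop)] at key
  have h1 := memLp_two_of_lintegral_sq_lt_top
    (f := fun z => h (act (CFC.sqrt V) 0) - h (act (CFC.sqrt V) z))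
    (Measurable.aestronglyMeasurable (by fun_prop))
    (key.trans_lt ENNReal.ofReal_lt_top)
  refine ((memLp_const (h (act (CFC.sqrt V) 0))).sub h1).congr_norm
    (Measurable.aestronglyMeasurable (by fun_prop))
    (ae_of_all _ fun z => ?_)
  simp

end Coupling

lemma covariance_sq_le {Ω : Type*} [MeasurableSpace Ω] {P : Measure Ω} [IsProbabilityMeasure P]
    {X Y : Ω → ℝ} (hX : MemLp X 2 P) (hY : MemLp Y 2 P) :
    cov[X, Y; P] ^ 2 ≤ Var[X; P] * Var[Y; P] := by
  have h (t : ℝ) : 0 ≤ Var[X; P] * (t * t) + 2 * cov[X, Y; P] * t + Var[Y; P] := by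
    have h0 := variance_nonneg (t • X + Y) P
    rw [variance_add (hX.const_smul t) hY, variance_smul, covariance_smul_left] at h0
    linarith
  have := discrim_le_zero h
  rw [discrim] at this
  linarith

lemma measurePreserving_inputs {Ω : Type*} [MeasurableSpace Ω] {P : Measure Ω}
    [IsProbabilityMeasure P] {d : ℕ} [NeZero d]
    {i : ℕ → Ω → Fin d} {g : ℕ → Ω → ℝ} {Z₀ : Ω → EuclideanSpace ℝ (Fin d)}
    (hi_meas : ∀ n, Measurable (i n)) (hg_meas : ∀ n, Measurable (g n)) (hZ_meas : Measurable Z₀)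
    (hi_unif : ∀ n, P.map (i n) = uniformOn Set.univ) (hi_indep : iIndepFun i P)
    (hg_gauss : ∀ n, P.map (g n) = gaussianReal 0 1) (hg_indep : iIndepFun g P)
    (hgi_indep : IndepFun (fun ω n => g n ω) (fun ω n => i n ω) P)
    (hZ_gauss : P.map Z₀ = stdGaussian (EuclideanSpace ℝ (Fin d)))
    (hZ_indep : IndepFun Z₀ (fun ω n => (g n ω, i n ω)) P) :
    MeasurePreserving (fun ω => ((fun n => i n ω), (fun n => g n ω), Z₀ ω)) P (inputLaw d) := by
  have hgm : Measurable fun ω n => g n ω := measurable_pi_lambda _ hg_meas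
  have him : Measurable fun ω n => i n ω := measurable_pi_lambda _ hi_meas
  have hg : P.map (fun ω n => g n ω) = gaussSeq := by
    rw [hg_indep.map_fun_eq_infinitePi_map hg_meas, gaussSeq]
    simp only [hg_gauss]
  have hi : P.map (fun ω n => i n ω) = indexSeq d := by
    rw [hi_indep.map_fun_eq_infinitePi_map hi_meas, indexSeq]
    simp only [hi_unif]
  have hgi := (indepFun_iff_map_prod_eq_prod_map_map hgm.aemeasurable him.aemeasurable).1 hgi_indep
  have hunzip : Measurable fun x : ℕ → ℝ × Fin d => ((fun n => (x n).1), fun n => (x n).2) := by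
    fun_prop
  have hZ : IndepFun Z₀ (fun ω => ((fun n => g n ω), fun n => i n ω)) P :=
    hZ_indep.comp measurable_id hunzip
  have hZgi := (indepFun_iff_map_prod_eq_prod_map_map hZ_meas.aemeasurable
    (hgm.prodMk him).aemeasurable).1 hZ
  rw [hgi, hg, hi, hZ_gauss] at hZgi
  have h1 : MeasurePreserving (fun ω => (Z₀ ω, (fun n => g n ω), fun n => i n ω)) P
      ((stdGaussian (EuclideanSpace ℝ (Fin d))).prod (gaussSeq.prod (indexSeq d))) :=
    ⟨hZ_meas.prodMk (hgm.prodMk him), hZgi⟩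
  have h2 := (MeasurePreserving.id (stdGaussian (EuclideanSpace ℝ (Fin d)))).prod
    (Measure.measurePreserving_swap (μ := gaussSeq) (ν := indexSeq d))
  have h3 := Measure.measurePreserving_swap (μ := stdGaussian (EuclideanSpace ℝ (Fin d)))
    (ν := (indexSeq d).prod gaussSeq)
  have h4 := measurePreserving_prodAssoc (indexSeq d) gaussSeq
    (stdGaussian (EuclideanSpace ℝ (Fin d)))
  exact h4.comp (h3.comp (h2.comp h1))

lemma measurable_chainZ_comp {d : ℕ} (V : Matrix (Fin d) (Fin d) ℝ) {α : Type*}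
    [MeasurableSpace α] {a : α → ℕ → Fin d} {b : α → ℕ → ℝ} {c : α → EuclideanSpace ℝ (Fin d)}
    (ha : Measurable a) (hb : Measurable b) (hc : Measurable c) (n : ℕ) :
    Measurable fun x => chainZ V (a x) (b x) (c x) n := by
  have h := ha.prodMk (hb.prodMk hc)
  have h1 := Measurable.comp (measurable_chainZ V n) h
  exact h1

lemma measurePreserving_chainZ {d : ℕ} [NeZero d] {V : Matrix (Fin d) (Fin d) ℝ}
    (hV : V.PosSemidef) (hdiag : ∀ k, V k k = 1) (n : ℕ) :
    MeasurePreserving (fun p : (ℕ → Fin d) × (ℕ → ℝ) × EuclideanSpace ℝ (Fin d) =>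
      chainZ V p.1 p.2.1 p.2.2 n) (inputLaw d) (stdGaussian (EuclideanSpace ℝ (Fin d))) := by
  have h1 : MeasurePreserving
      (fun p : (ℕ → Fin d) × (ℕ → ℝ) × EuclideanSpace ℝ (Fin d) => p.2.2) (inputLaw d)
      (stdGaussian (EuclideanSpace ℝ (Fin d))) :=
    measurePreserving_snd.comp measurePreserving_snd
  convert h1.comp ((measurePreserving_restart hV hdiag).iterate n) using 1
  ext1 p
  have := chainZ_add V p n 0
  rw [add_zero, chainZ_zero] at this
  rw [this]
  rfl

lemma covariance_comp_chainZ_add {d : ℕ} [NeZero d] {V : Matrix (Fin d) (Fin d) ℝ}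
    (hV : V.PosSemidef) (hdiag : ∀ k, V k k = 1) {f : EuclideanSpace ℝ (Fin d) → ℝ}
    (hf : Measurable f) (j k : ℕ) :
    cov[fun p => f (chainZ V p.1 p.2.1 p.2.2 j),
      fun p => f (chainZ V p.1 p.2.1 p.2.2 (j + k)); inputLaw d] =
    cov[fun p => f (chainZ V p.1 p.2.1 p.2.2 0), fun p => f (chainZ V p.1 p.2.1 p.2.2 k);
      inputLaw d] := by
  have hm (n : ℕ) : Measurable fun p : (ℕ → Fin d) × (ℕ → ℝ) × EuclideanSpace ℝ (Fin d) =>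
      f (chainZ V p.1 p.2.1 p.2.2 n) := hf.comp (measurable_chainZ V n)
  have hT := (measurePreserving_restart hV hdiag).iterate j
  conv_rhs => rw [← hT.map_eq]
  rw [covariance_map_fun (hm 0).aestronglyMeasurable (hm k).aestronglyMeasurable
    hT.measurable.aemeasurable]
  simp only [← chainZ_add, add_zero]

end GaussSim

theorem mainTheorem3 {Ω : Type*} [MeasurableSpace Ω] (P : Measure Ω) [IsProbabilityMeasure P]
    (d : ℕ) (V : Matrix (Fin d) (Fin d) ℝ) (hV : V.PosDef) (hdiag : ∀ k, V k k = 1)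
    (i : ℕ → Ω → Fin d) (g : ℕ → Ω → ℝ) (Z₀ : Ω → EuclideanSpace ℝ (Fin d))
    (hi_meas : ∀ n, Measurable (i n)) (hg_meas : ∀ n, Measurable (g n)) (hZ_meas : Measurable Z₀)
    (hi_unif : ∀ n, P.map (i n) = uniformOn Set.univ)
    (hi_indep : iIndepFun i P)
    (hg_gauss : ∀ n, P.map (g n) = gaussianReal 0 1)
    (hg_indep : iIndepFun g P)
    (hgi_indep : IndepFun (fun ω n => g n ω) (fun ω n => i n ω) P)
    (hZ_gauss : P.map Z₀ = stdGaussian (EuclideanSpace ℝ (Fin d)))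
    (hZ_indep : IndepFun Z₀ (fun ω n => (g n ω, i n ω)) P)
    (κ γ : ℝ) (hκ : 0 < κ) (hγ0 : 0 < γ) (hγ1 : γ ≤ 1)
    (h : EuclideanSpace ℝ (Fin d) → ℝ) (hh : GaussSim.IsGaussLipschitz κ γ V h) :
    MemLp h 2 (multivariateGaussian 0 V) ∧
    (∀ n, MemLp (GaussSim.obsX V h i g n) 2 P) ∧
    (∀ n, MemLp (GaussSim.obsZ V h i g Z₀ n) 2 P) ∧
    Summable (fun j : ℕ =>
      cov[GaussSim.obsZ V h i g Z₀ 0, GaussSim.obsZ V h i g Z₀ (j + 1); P]) ∧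
    Tendsto (fun n : ℕ => (n : ℝ) * GaussSim.mse P V h i g n) atTop
      (𝓝 (GaussSim.asympVar P V h i g Z₀)) := by
  have hP : Nonempty Ω := P.nonempty_of_neZero
  have : NeZero d := ⟨fun h0 => by
    subst h0
    exact (i 0 hP.some).elim0⟩
  set Φ : Ω → (ℕ → Fin d) × (ℕ → ℝ) × EuclideanSpace ℝ (Fin d) :=
    fun ω => ((fun n => i n ω), (fun n => g n ω), Z₀ ω) with hΦ
  have hΦP : MeasurePreserving Φ P (GaussSim.inputLaw d) :=
    GaussSim.measurePreserving_inputs hi_meas hg_meas hZ_meas hi_unif hi_indep hg_gauss hg_indep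
      hgi_indep hZ_gauss hZ_indep
  have hV' := hV.posSemidef
  have hhm := hh.1
  set f : EuclideanSpace ℝ (Fin d) → ℝ := fun z => h (GaussSim.act (CFC.sqrt V) z) with hf
  have hfm : Measurable f := by fun_prop
  have hf2 : MemLp f 2 (stdGaussian (EuclideanSpace ℝ (Fin d))) :=
    GaussSim.memLp_comp_sqrt hV' hh
  have hsqrt : MeasurePreserving (GaussSim.act (CFC.sqrt V))
      (stdGaussian (EuclideanSpace ℝ (Fin d))) (multivariateGaussian 0 V) := by
    refine ⟨GaussSim.measurable_act _, ?_⟩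
    simp only [multivariateGaussian, zero_add]
    rfl
  have hmean : GaussSim.gaussMean V h = ∫ z, f z ∂(stdGaussian (EuclideanSpace ℝ (Fin d))) := by
    rw [GaussSim.gaussMean, ← hsqrt.map_eq,
      integral_map hsqrt.measurable.aemeasurable hhm.aestronglyMeasurable]
  have hZn (n : ℕ) : MeasurePreserving (fun ω => GaussSim.chainZ V (Φ ω).1 (Φ ω).2.1 (Φ ω).2.2 n) P
      (stdGaussian (EuclideanSpace ℝ (Fin d))) :=
    (GaussSim.measurePreserving_chainZ hV' hdiag n).comp hΦP
  have ha (n : ℕ) : MemLp (GaussSim.obsZ V h i g Z₀ n) 2 P :=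
    hf2.comp_measurePreserving (hZn n)
  have hbeq (n : ℕ) : GaussSim.obsX V h i g n =
      fun ω => f (GaussSim.chainZ V (Φ ω).1 (Φ ω).2.1 0 n) := by
    ext ω
    rw [GaussSim.obsX, GaussSim.chainX_eq hV', GaussSim.chainZ_apply_zero]
  have hbm (n : ℕ) : Measurable (GaussSim.obsX V h i g n) := by
    rw [hbeq]
    exact hfm.comp (GaussSim.measurable_chainZ_comp V hΦP.measurable.fst hΦP.measurable.snd.fst
      measurable_const n)
  obtain ⟨C, r, hC, hr0, hr1, hCr⟩ := GaussSim.exists_lintegral_sub_sq_le hV hdiag hγ0 hγ1 hh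
  have hdiff (n : ℕ) : ∫⁻ ω, ENNReal.ofReal
      ((GaussSim.obsX V h i g n - GaussSim.obsZ V h i g Z₀ n) ω ^ 2) ∂P ≤
        ENNReal.ofReal (C * r ^ n) := by
    refine le_trans (le_of_eq ?_) (hCr n)
    have h2 := hfm.comp (GaussSim.measurable_chainZ_comp V
      (α := (ℕ → Fin d) × (ℕ → ℝ) × EuclideanSpace ℝ (Fin d)) measurable_fst
      measurable_snd.fst (measurable_const (a := 0)) n)
    have h3 := hfm.comp (GaussSim.measurable_chainZ V n)
    have h4 := hΦP.lintegral_comp (ENNReal.measurable_ofReal.comp ((h2.sub h3).pow_const 2))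
    simp only [Function.comp_def, GaussSim.chainZ_apply_zero] at h4
    refine Eq.trans (lintegral_congr fun ω => ?_) h4
    rw [Pi.sub_apply, hbeq]
    simp only [Pi.sub_apply, GaussSim.chainZ_apply_zero]
    rfl
  have hD (n : ℕ) : MemLp (GaussSim.obsX V h i g n - GaussSim.obsZ V h i g Z₀ n) 2 P :=
    GaussSim.memLp_two_of_lintegral_sq_lt_top
      ((hbm n).aestronglyMeasurable.sub (ha n).aestronglyMeasurable)
      ((hdiff n).trans_lt ENNReal.ofReal_lt_top)
  have hb (n : ℕ) : MemLp (GaussSim.obsX V h i g n) 2 P := by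
    have := (ha n).add (hD n)
    rwa [add_sub_cancel] at this
  have hDvar (n : ℕ) : Var[GaussSim.obsX V h i g n - GaussSim.obsZ V h i g Z₀ n; P] ≤ C * r ^ n := by
    refine (variance_le_expectation_sq (hD n).aestronglyMeasurable).trans ?_
    simp only [Pi.pow_apply]
    rw [integral_eq_lintegral_of_nonneg_ae (ae_of_all _ fun _ => sq_nonneg _)
      ((hD n).aestronglyMeasurable.pow 2)]
    exact ENNReal.toReal_le_of_le_ofReal (by positivity) (hdiff n)
  have hcov0 (n : ℕ) : cov[GaussSim.obsZ V h i g Z₀ 0, GaussSim.obsX V h i g n; P] = 0 := by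
    have hψ : Measurable fun x : ℕ → ℝ × Fin d =>
        f (GaussSim.chainZ V (fun n => (x n).2) (fun n => (x n).1) 0 n) :=
      hfm.comp (GaussSim.measurable_chainZ_comp V (by fun_prop) (by fun_prop) measurable_const n)
    have hind := hZ_indep.comp hfm hψ
    refine IndepFun.covariance_eq_zero ?_ (ha 0) (hb n)
    rw [hbeq]
    convert hind using 1
    · ext ω
      simp [GaussSim.obsZ, GaussSim.chainZ_zero, hf]
    · rfl
  have hsum : Summable (fun j : ℕ =>
      cov[GaussSim.obsZ V h i g Z₀ 0, GaussSim.obsZ V h i g Z₀ (j + 1); P]) := by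
    have hgeo : Summable fun j : ℕ =>
        √(Var[GaussSim.obsZ V h i g Z₀ 0; P] * C) * √r ^ (j + 1) := by
      refine Summable.mul_left _ ((summable_nat_add_iff 1).2
        (summable_geometric_of_lt_one (Real.sqrt_nonneg r) ?_))
      rw [Real.sqrt_lt' one_pos]
      simpa using hr1
    refine Summable.of_norm_bounded hgeo fun j => ?_
    have h1 : cov[GaussSim.obsZ V h i g Z₀ 0, GaussSim.obsZ V h i g Z₀ (j + 1); P] =
        -cov[GaussSim.obsZ V h i g Z₀ 0,
          GaussSim.obsX V h i g (j + 1) - GaussSim.obsZ V h i g Z₀ (j + 1); P] := by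
      rw [covariance_sub_right (ha 0) (hb _) (ha _), hcov0]
      ring
    rw [h1, norm_neg, Real.norm_eq_abs]
    refine abs_le_of_sq_le_sq ?_ (by positivity)
    refine (GaussSim.covariance_sq_le (ha 0) (hD _)).trans ?_
    rw [mul_pow, Real.sq_sqrt (mul_nonneg (variance_nonneg _ _) hC), ← pow_mul, mul_comm (j + 1),
      pow_mul, Real.sq_sqrt hr0, mul_assoc]
    exact mul_le_mul_of_nonneg_left (hDvar _) (variance_nonneg _ _)
  have hstat (j k : ℕ) : cov[GaussSim.obsZ V h i g Z₀ j, GaussSim.obsZ V h i g Z₀ (j + k); P] =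
      cov[GaussSim.obsZ V h i g Z₀ 0, GaussSim.obsZ V h i g Z₀ k; P] := by
    have key (j k : ℕ) : cov[GaussSim.obsZ V h i g Z₀ j, GaussSim.obsZ V h i g Z₀ k; P] =
        cov[fun p => f (GaussSim.chainZ V p.1 p.2.1 p.2.2 j),
          fun p => f (GaussSim.chainZ V p.1 p.2.1 p.2.2 k); GaussSim.inputLaw d] := by
      have hm (n : ℕ) : Measurable fun p : (ℕ → Fin d) × (ℕ → ℝ) × EuclideanSpace ℝ (Fin d) =>
          f (GaussSim.chainZ V p.1 p.2.1 p.2.2 n) := hfm.comp (GaussSim.measurable_chainZ V n)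
      rw [← hΦP.map_eq, covariance_map_fun (hm j).aestronglyMeasurable
        (hm k).aestronglyMeasurable hΦP.measurable.aemeasurable]
      rfl
    rw [key, key, GaussSim.covariance_comp_chainZ_add hV' hdiag hfm]
  have hma (n : ℕ) : ∫ ω, GaussSim.obsZ V h i g Z₀ n ω ∂P = GaussSim.gaussMean V h := by
    rw [hmean, ← (hZn n).map_eq,
      integral_map (hZn n).measurable.aemeasurable hfm.aestronglyMeasurable]
    rfl
  have hK (n : ℕ) : ∑ j ∈ Finset.range n,
      eLpNorm (GaussSim.obsX V h i g j - GaussSim.obsZ V h i g Z₀ j) 2 P ≤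
        ENNReal.ofReal (∑' j : ℕ, √C * √r ^ j) := by
    have hgeo : Summable fun j : ℕ => √C * √r ^ j := by
      refine Summable.mul_left _ (summable_geometric_of_lt_one (Real.sqrt_nonneg r) ?_)
      rw [Real.sqrt_lt' one_pos]
      simpa using hr1
    have h1 (j : ℕ) : eLpNorm (GaussSim.obsX V h i g j - GaussSim.obsZ V h i g Z₀ j) 2 P ≤
        ENNReal.ofReal (√C * √r ^ j) := by
      refine (ENNReal.pow_le_pow_left_iff two_ne_zero).1 ?_
      rw [GaussSim.eLpNorm_two_sq, ← ENNReal.ofReal_pow (by positivity), mul_pow, Real.sq_sqrt hC,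
        ← pow_mul, mul_comm j, pow_mul, Real.sq_sqrt hr0]
      exact hdiff j
    refine (Finset.sum_le_sum fun j _ => h1 j).trans ?_
    rw [← ENNReal.ofReal_sum_of_nonneg fun j _ => by positivity]
    exact ENNReal.ofReal_le_ofReal (hgeo.sum_le_tsum _ fun j _ => by positivity)
  refine ⟨?_, hb, ha, hsum, ?_⟩
  · rw [← hsqrt.map_eq, memLp_map_measure_iff hhm.aestronglyMeasurable
      hsqrt.measurable.aemeasurable]
    exact hf2
  · have := GaussSim.tendsto_mul_integral_sq_of_stationary ha hb hma hstat hsum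
      ENNReal.ofReal_ne_top hK
    rw [covariance_self (ha 0).aestronglyMeasurable.aemeasurable] at this
    exact this
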